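/- Let \(T=T(l)\) be a labeled tree, that is, a connected nonempty graph without cycles (possibly infinite) together with a map \(l\colon V(T)\to[0,\infty)\). For a nonempty metric space \((A,d)\), the diametrical graph \(G_A\) has vertex set \(A\), and distinct \(x,y\in A\) are adjacent iff \(d(x,y)=\operatorname{diam}A\). A subset of \(A\) is a part of \(G_A\) if it is one of the blocks of a partition of \(A\) into at least two nonempty sets such that two points are adjacent in \(G_A\) exactly when they lie in different blocks. For a nonempty totally bounded ultrametric space \((X,d)\), the labeled representing tree \(T_X(l_X)\) is defined as follows: its vertices are the sets \(A\subseteq X\) for which there is a finite sequence \(X=X_1,\dots,X_n=A\) such that \(X_{i+1}\) is a part of \(G_{X_i}\) for every \(1\le i<n\) (where \(X_i\) carries the restricted metric); two vertices are adjacent iff one of them is a part of the diametrical graph of the other; and \(l_X(A)=\operatorname{diam}A\). An isomorphism of labeled trees is a graph isomorphism that preserves the labels. For a root \(r\in V(T)\), write \(v_1\preccurlyeq v_2\) if every vertex of the path in \(T\) from \(v_2\) to \(r\) lies on the path from \(v_1\) to \(r\). A vertex \(v\) is a direct successor of \(u\) if \(v\prec u\) and there is no vertex strictly between them. The out-degree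 \(\delta^+(v)\) is the degree of \(v\) if \(v=r\), and the degree of \(v\) minus \(1\) otherwise. The map \(l\) is a monotone labeling on the rooted tree \(T(r)\) if \(l(v)<l(u)\) whenever \(v\) is a direct successor of \(u\), and \(\inf_{v\in C}l(v)=0\) for every maximal chain \(C\) of \((V(T),\preccurlyeq)\). Then the following statements are equivalent: 1. There is a nonempty compact ultrametric space \((X,d)\) such that \(T_X(l_X)\) is isomorphic to \(T(l)\). 2. There is a nonempty totally bounded ultrametric space \((Y,\rho)\) such that \(T_Y(l_Y)\) is isomorphic to \(T(l)\). 3. \(T\) is locally finite (every vertex has finite degree), and there is \(r\in V(T)\) such that \(l\) is a monotone labeling on \(T(r)\) and \(\delta^+(u)\neq 1\) for every \(u\in V(T)\). -/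

import Mathlib

open scoped NNReal

universe u

namespace UltrametricTree

/-! ### Complete multipartite graphs and diametrical graphs -/

/-- `P` is a partition of the vertex set of `G` into at least two nonempty disjoint parts such
that no edge has both ends in one part and any two vertices of different parts are adjacent. -/
def IsCompletePartition {W : Type u} (G : SimpleGraph W) (P : Set (Set W)) : Prop :=
  Setoid.IsPartition P ∧ P.Nontrivial ∧
    (∀ A ∈ P, ∀ x ∈ A, ∀ y ∈ A, ¬ G.Adj x y) ∧
    (∀ A ∈ P, ∀ B ∈ P, A ≠ B → ∀ x ∈ A, ∀ y ∈ B, G.Adj x y)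

/-- `S` is a part of the complete multipartite graph `G` (false when `G` is not complete
`k`-partite for any `k ≥ 2`). -/
def IsPart {W : Type u} (G : SimpleGraph W) (S : Set W) : Prop :=
  ∃ P : Set (Set W), IsCompletePartition G P ∧ S ∈ P

/-- The diametrical graph of a metric space: distinct points are adjacent when their distance
is the diameter of the space. (If the space is unbounded, `Metric.diam` is `0` and the graph has
no edges, in agreement with an infinite diameter that is never attained.) -/
def diametricalGraph (X : Type u) [MetricSpace X] : SimpleGraph X where
  Adj x y := dist x y = Metric.diam (Set.univ : Set X) ∧ x ≠ y
  symm := ⟨fun x y h => ⟨by rw [dist_comm]; exact h.1, h.2.symm⟩⟩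
  loopless := ⟨fun _ h => h.2 rfl⟩

/-- `B` is a part of the diametrical graph of the subspace `A` of `X`. -/
def IsDiamPart {X : Type u} [MetricSpace X] (A B : Set X) : Prop :=
  ∃ S : Set A, IsPart (diametricalGraph A) S ∧ B = Subtype.val '' S

theorem not_isDiamPart_self {X : Type u} [MetricSpace X] (A : Set X) : ¬ IsDiamPart A A := by
  rintro ⟨S, ⟨P, ⟨hP, hnt, -, -⟩, hS⟩, hA⟩
  have hS' : S = Set.univ := by
    ext x
    have hx : (x : X) ∈ Subtype.val '' S := hA ▸ x.2
    obtain ⟨y, hy, hyx⟩ := hx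
    simpa using (Subtype.ext hyx : y = x) ▸ hy
  obtain ⟨B, hB, hBS⟩ := hnt.exists_ne S
  obtain ⟨b, hb⟩ := Setoid.nonempty_of_mem_partition hP hB
  exact hBS ((hP.2 b).unique ⟨hB, hb⟩ ⟨hS, by rw [hS']; trivial⟩)

/-! ### The labeled representing tree -/

/-- The vertices of the representing tree `T_X`: the sets that are reached from `X` by a finite
sequence `X = X₁, …, Xₙ` in which `Xᵢ₊₁` is a part of the diametrical graph of `Xᵢ`. -/
def reprVertices (X : Type u) [MetricSpace X] : Set (Set X) :=
  {A | Relation.ReflTransGen IsDiamPart Set.univ A}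

/-- The representing tree `T_X`: two vertices are adjacent when one of them is a part of the
diametrical graph of the other. -/
def reprTree (X : Type u) [MetricSpace X] : SimpleGraph (reprVertices X) where
  Adj A B := IsDiamPart (B : Set X) (A : Set X) ∨ IsDiamPart (A : Set X) (B : Set X)
  symm := ⟨fun _ _ h => h.symm⟩
  loopless := ⟨fun A h => not_isDiamPart_self (A : Set X) (h.elim id id)⟩

/-- The labeling `l_X` of the representing tree by diameters. -/
noncomputable def reprLabel (X : Type u) [MetricSpace X] (A : reprVertices X) : ℝ≥0 :=
  ⟨Metric.diam (A : Set X), Metric.diam_nonneg⟩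

/-- Isomorphism of labeled graphs: a graph isomorphism that preserves the labels. -/
def LabeledIsomorphic {V₁ V₂ : Type u} (T₁ : SimpleGraph V₁) (l₁ : V₁ → ℝ≥0)
    (T₂ : SimpleGraph V₂) (l₂ : V₂ → ℝ≥0) : Prop :=
  ∃ f : T₁ ≃g T₂, ∀ v : V₁, l₂ (f v) = l₁ v

/-! ### Rooted trees and monotone labelings -/

/-- The degree of a vertex. -/
noncomputable def degree {V : Type u} (T : SimpleGraph V) (v : V) : ℕ∞ :=
  (T.neighborSet v).encard

/-- Every vertex has finite degree. -/
def IsLocallyFinite {V : Type u} (T : SimpleGraph V) : Prop :=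
  ∀ v : V, degree T v < ⊤

open Classical in
/-- The out-degree of a vertex of the tree `T` with root `r`. -/
noncomputable def outDegree {V : Type u} (T : SimpleGraph V) (r v : V) : ℕ∞ :=
  if v = r then degree T v else degree T v - 1

/-- The set of vertices of the path that joins `v` with `r` (it is unique in a tree, and has
the single vertex `r` if `v = r`). -/
def pathVertices {V : Type u} (T : SimpleGraph V) (r v : V) : Set V :=
  {w | ∃ p : T.Walk v r, p.IsPath ∧ w ∈ p.support}

/-- The order on the vertices of a tree with root `r`; the root is the largest element. -/
def RootedLE {V : Type u} (T : SimpleGraph V) (r v₁ v₂ : V) : Prop :=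
  pathVertices T r v₂ ⊆ pathVertices T r v₁

/-- `v` is a direct successor of `w`, that is, a lower cover of `w` in the order of the rooted
tree. -/
def IsDirectSuccessor {V : Type u} (T : SimpleGraph V) (r v w : V) : Prop :=
  RootedLE T r v w ∧ v ≠ w ∧ ∀ z : V, RootedLE T r v z → RootedLE T r z w → z = v ∨ z = w

/-- `l` is a monotone labeling on the tree `T` with root `r`: labels strictly decrease along
direct successors, and the infimum of the labels over every maximal chain is `0`. -/
def IsMonotoneLabeling {V : Type u} (T : SimpleGraph V) (r : V) (l : V → ℝ≥0) : Prop :=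
  (∀ v w : V, IsDirectSuccessor T r v w → l v < l w) ∧
    ∀ C : Set V, IsMaxChain (RootedLE T r) C → IsGLB (l '' C) 0

end UltrametricTree

open UltrametricTree

/-!
A rooted tree is governed by its child relation, and all notions of the statement translate to it:
`rootedLE_iff`, `isDirectSuccessor_iff`, `outDegree_eq`, `isLocallyFinite_iff`. In an ultrametric
space the parts of the diametrical graph of a set `A` of positive, attained diameter `d` are the
traces on `A` of open balls of radius `d` (`isDiamPart_iff`).

A compact space is totally bounded. In a totally bounded ultrametric space only finitely many
distances exceed a given positive number (`finite_setOf_dist_ge`). Hence diameters are attained, a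
set of positive diameter has at least two but only finitely many parts, and these have smaller
diameter. Take the whole space as root. Labels decrease from the root, so "being a part of" is the
child relation of the tree (`child_iff_of_orientation`). If the labels of a maximal chain had a
positive lower bound, a vertex of the chain with the least label would have a child, which could
be added to the chain (`monotone_of_totallyBounded`).

Conversely, given a locally finite tree with a monotone labeling, let `X` be the space of rays from
the root (maximal chains), where two rays have as distance the label of the vertex at which they
separate. This is an ultrametric. The rays through `v` form a set of diameter `l v`, because no
vertex has exactly one child, and its parts are the sets of rays through the children of `v`
(`Ray.isDiamPart_through_iff`). So the tree is the representing tree of `X`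
(`labeledIsomorphic_of_family`). Compactness of `X` is an ultrafilter argument in the spirit of
Kőnig's lemma (`Ray.compactSpace`): the selected ray is a limit as the labels along it tend to `0`.
-/

namespace UltrametricTree

open Relation

/-! ### Rooted trees -/

/-- `v` is a child of `u` in the tree `T` with root `r`: a neighbor of `u` one step further away
from the root. -/
def Child {V : Type u} (T : SimpleGraph V) (r u v : V) : Prop :=
  T.Adj u v ∧ T.dist r v = T.dist r u + 1

section Tree

variable {V : Type u} {T : SimpleGraph V} {r u v w : V}

theorem not_child_root : ¬ Child T r u r := fun h => by simpa using h.2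

theorem Child.irrefl : ¬ Child T r u u := fun h => h.1.ne rfl

theorem adj_iff_child (hT : T.IsTree) (r : V) : T.Adj u v ↔ Child T r u v ∨ Child T r v u := by
  refine ⟨fun h => ?_, fun h => h.elim And.left fun h => h.1.symm⟩
  rcases hT.dist_eq_dist_add_one_of_adj r h with h' | h'
  · exact Or.inr ⟨h.symm, h'⟩
  · exact Or.inl ⟨h, h'⟩

theorem dist_le_of_mem_support_geodesic {p : T.Walk u r} (hp : p.length = T.dist u r)
    (hw : w ∈ p.support) : T.dist w r ≤ T.dist u r := by
  classical
  rw [← hp]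
  exact (SimpleGraph.dist_le (p.dropUntil w hw)).trans (p.length_dropUntil_le_length hw)

/-- In a rooted tree the parent of a vertex is unique: continuing geodesics from two parents to
the root gives two paths that have to agree. -/
theorem Child.parent_unique (hT : T.IsTree) (hu : Child T r u w) (hv : Child T r v w) :
    u = v := by
  have key : ∀ x, Child T r x w → ∃ p : T.Walk w r, p.IsPath ∧ p.snd = x := by
    intro x hx
    obtain ⟨p, hp, hl⟩ := hT.connected.exists_path_of_dist x r
    refine ⟨.cons hx.1.symm p, hp.cons fun hw => ?_, by simp⟩
    have h1 := dist_le_of_mem_support_geodesic hl hw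
    have h2 := hx.2
    rw [T.dist_comm (u := w), T.dist_comm (u := x)] at h1
    omega
  obtain ⟨p, hp, rfl⟩ := key u hu
  obtain ⟨q, hq, rfl⟩ := key v hv
  rw [(hT.existsUnique_path w r).unique hp hq]

theorem exists_parent (hT : T.IsTree) (hv : v ≠ r) : ∃ u, Child T r u v := by
  obtain ⟨p, hl⟩ := hT.connected.exists_walk_length_eq_dist v r
  cases p with
  | nil => exact absurd rfl hv
  | @cons _ u _ h p =>
    refine ⟨u, h.symm, ?_⟩
    have h1 := SimpleGraph.dist_le p
    rw [SimpleGraph.Walk.length_cons] at hl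
    rw [T.dist_comm (u := v)] at hl
    rw [T.dist_comm (v := r)] at h1
    rcases hT.dist_eq_dist_add_one_of_adj r h with h' | h' <;> omega

theorem reflTransGen_child_root (hT : T.IsTree) (r v : V) : ReflTransGen (Child T r) r v := by
  induction hn : T.dist r v generalizing v with
  | zero => rw [hT.connected.dist_eq_zero_iff.1 hn]
  | succ n ih =>
    obtain ⟨u, hu⟩ := exists_parent hT (r := r) (v := v) (by rintro rfl; simp at hn)
    exact (ih u (by have := hu.2; omega)).tail hu

theorem dist_le_of_reflTransGen_child (h : ReflTransGen (Child T r) u v) :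
    T.dist r u ≤ T.dist r v := by
  induction h with
  | refl => exact le_rfl
  | tail _ h ih => have := h.2; omega

theorem eq_of_reflTransGen_child_of_dist_le (h : ReflTransGen (Child T r) u v)
    (hd : T.dist r v ≤ T.dist r u) : u = v := by
  rcases h.cases_tail with h | ⟨w, hw, h⟩
  · exact h.symm
  · have := dist_le_of_reflTransGen_child hw
    have := h.2
    omega

theorem label_le_of_reflTransGen_child {l : V → ℝ≥0} (hl : ∀ u v, Child T r u v → l v < l u)
    (h : ReflTransGen (Child T r) u v) : l v ≤ l u := by
  induction h with
  | refl => exact le_rfl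
  | tail _ h ih => exact (hl _ _ h).le.trans ih

/-- The ancestors of a vertex are the vertex itself and the ancestors of its parent. -/
theorem reflTransGen_child_iff (hT : T.IsTree) (h : Child T r u v) :
    ReflTransGen (Child T r) w v ↔ w = v ∨ ReflTransGen (Child T r) w u := by
  refine ⟨fun hw => ?_, ?_⟩
  · rcases hw.cases_tail with hw | ⟨x, hx, hxv⟩
    · exact Or.inl hw.symm
    · exact Or.inr (hxv.parent_unique hT h ▸ hx)
  · rintro (rfl | hw)
    · exact .refl
    · exact hw.tail h

/-- The path from `v` to the root consists of the ancestors of `v`. -/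
theorem mem_pathVertices_iff (hT : T.IsTree) :
    w ∈ pathVertices T r v ↔ ReflTransGen (Child T r) w v := by
  have key : ∀ v, ReflTransGen (Child T r) r v → ∃ p : T.Walk v r, p.IsPath ∧
      ∀ w, w ∈ p.support ↔ ReflTransGen (Child T r) w v := by
    intro v hv
    induction hv with
    | refl =>
      refine ⟨.nil, .nil, fun w => ?_⟩
      simp only [SimpleGraph.Walk.support_nil, List.mem_singleton]
      refine ⟨by rintro rfl; exact .refl, fun h => ?_⟩
      rcases h.cases_tail with h | ⟨_, _, h⟩
      · exact h.symm
      · exact (not_child_root h).elim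
    | @tail u v _ huv ih =>
      obtain ⟨p, hp, hs⟩ := ih
      refine ⟨.cons huv.1.symm p, hp.cons fun h => ?_, fun w => ?_⟩
      · have h1 := dist_le_of_reflTransGen_child ((hs v).1 h)
        have h2 := huv.2
        omega
      · rw [SimpleGraph.Walk.support_cons, List.mem_cons, hs, reflTransGen_child_iff hT huv]
  obtain ⟨p, hp, hs⟩ := key v (reflTransGen_child_root hT r v)
  rw [← hs]
  refine ⟨?_, fun h => ⟨p, hp, h⟩⟩
  rintro ⟨q, hq, hw⟩
  rwa [(hT.existsUnique_path v r).unique hp hq]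

theorem rootedLE_iff (hT : T.IsTree) : RootedLE T r v w ↔ ReflTransGen (Child T r) w v := by
  simp only [RootedLE, Set.subset_def, mem_pathVertices_iff hT]
  exact ⟨fun h => h w .refl, fun h x hx => hx.trans h⟩

theorem isDirectSuccessor_iff (hT : T.IsTree) : IsDirectSuccessor T r v w ↔ Child T r w v := by
  simp only [IsDirectSuccessor, rootedLE_iff hT]
  constructor
  · rintro ⟨h, hne, hz⟩
    rcases h.cases_tail with h | ⟨u, hu, huv⟩
    · exact (hne h).elim
    · rcases hz u (.single huv) hu with rfl | rfl
      · exact (Child.irrefl huv).elim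
      · exact huv
  · intro h
    refine ⟨.single h, fun e => h.1.ne e.symm, fun z hz hzw => ?_⟩
    rcases (reflTransGen_child_iff hT h).1 hz with rfl | hz
    · exact Or.inl rfl
    · exact Or.inr (eq_of_reflTransGen_child_of_dist_le hz (dist_le_of_reflTransGen_child hzw))

theorem outDegree_eq (hT : T.IsTree) : outDegree T r v = {w | Child T r v w}.encard := by
  unfold outDegree degree
  split_ifs with h
  · subst h
    congr 1
    ext w
    simp [adj_iff_child hT v, not_child_root]
  · obtain ⟨u, hu⟩ := exists_parent hT h
    have : T.neighborSet v = insert u {w | Child T r v w} := by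
      ext w
      simp only [SimpleGraph.mem_neighborSet, adj_iff_child hT r, Set.mem_insert_iff,
        Set.mem_ofPred_eq]
      refine ⟨?_, ?_⟩
      · rintro (h | h)
        · exact Or.inr h
        · exact Or.inl (h.parent_unique hT hu)
      · rintro (rfl | h)
        · exact Or.inr hu
        · exact Or.inl h
    rw [this, Set.encard_insert_of_notMem]
    · exact ENat.addLECancellable_of_ne_top (by simp) |>.add_tsub_cancel_right
    · intro h
      have h1 := h.2
      have h2 := hu.2
      omega

theorem isLocallyFinite_iff (hT : T.IsTree) (r : V) :
    IsLocallyFinite T ↔ ∀ v, {w | Child T r v w}.Finite := by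
  simp only [IsLocallyFinite, degree, Set.encard_lt_top_iff]
  refine forall_congr' fun v => ⟨fun h => h.subset fun w hw => hw.1, fun h => ?_⟩
  have hp : {w | Child T r w v}.Finite :=
    Set.Subsingleton.finite fun a ha b hb => ha.parent_unique hT hb
  exact (h.union hp).subset fun w hw => (adj_iff_child hT r).1 hw

theorem IsMonotoneLabeling.lt_of_child {l : V → ℝ≥0} (hT : T.IsTree)
    (hl : IsMonotoneLabeling T r l) (u v : V) (h : Child T r u v) : l v < l u :=
  hl.1 _ _ ((isDirectSuccessor_iff hT).2 h)

/-- A relation that orients the edges of a tree, reaches every vertex from `r`, and decreases a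
labeling is the child relation of the tree with root `r`. -/
theorem child_iff_of_orientation (hT : T.IsTree) {R : V → V → Prop} {l : V → ℝ≥0}
    (hadj : ∀ u v, T.Adj u v ↔ R u v ∨ R v u) (hr : ∀ v, ReflTransGen R r v)
    (hl : ∀ u v, R u v → l v < l u) : Child T r u v ↔ R u v := by
  have key : ∀ u, ReflTransGen R r u → ∀ v, R u v → Child T r u v := by
    intro u hu
    induction hu with
    | refl =>
      intro v hv
      have h := (hadj _ _).2 (Or.inl hv)
      exact ⟨h, by rw [T.dist_self, SimpleGraph.dist_eq_one_iff_adj.2 h]⟩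
    | @tail x u _ hxu ih =>
      intro v hv
      rcases (adj_iff_child hT r).1 ((hadj _ _).2 (Or.inl hv)) with h | h
      · exact h
      -- otherwise `v` would be the parent `x` of `u`, whose label is too large
      · obtain rfl := h.parent_unique hT (ih u hxu)
        exact absurd (hl _ _ hv) (hl _ _ hxu).le.not_gt
  refine ⟨fun h => ?_, key u (hr u) v⟩
  rcases (hadj _ _).1 h.1 with h' | h'
  · exact h'
  · have h1 := (key v (hr v) u h').2
    have h2 := h.2
    omega

end Tree

/-! ### Diametrical graphs of ultrametric spaces -/

section Metric

variable {X : Type u} [MetricSpace X] {A B : Set X}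

theorem diam_univ_subtype (A : Set X) : Metric.diam (Set.univ : Set A) = Metric.diam A := by
  rw [← isometry_subtype_coe.diam_range, Subtype.range_coe]

/-- `A` is bounded and has two points whose distance is the diameter of `A`. Boundedness is part of
the condition because `Metric.diam` is `0` on unbounded sets. -/
def DiamAttained (A : Set X) : Prop :=
  Bornology.IsBounded A ∧ ∃ x ∈ A, ∃ y ∈ A, dist x y = Metric.diam A

/-- In an ultrametric space the parts of the diametrical graph of `A` are the traces on `A` of the
open balls whose centers are in `A` and whose radius is the diameter of `A`. -/
theorem isDiamPart_iff [IsUltrametricDist X] (hA : DiamAttained A) :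
    IsDiamPart A B ↔
      0 < Metric.diam A ∧ ∃ x ∈ A, B = A ∩ Metric.ball x (Metric.diam A) := by
  obtain ⟨hb, a, ha, b, hb', hab⟩ := hA
  have hle : ∀ x y : A, dist x y ≤ Metric.diam A := fun x y =>
    Metric.dist_le_diam_of_mem hb x.2 y.2
  constructor
  · rintro ⟨S, ⟨P, ⟨hP, hnt, hin, hout⟩, hS⟩, rfl⟩
    obtain ⟨S', hS', hne⟩ := hnt.exists_ne S
    obtain ⟨x, hx⟩ := Setoid.nonempty_of_mem_partition hP hS
    obtain ⟨y, hy⟩ := Setoid.nonempty_of_mem_partition hP hS'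
    have hxy := hout S hS S' hS' hne.symm x hx y hy
    have hpos : 0 < Metric.diam A := by
      have h := hxy.1
      rw [diam_univ_subtype] at h
      rw [← h]
      exact dist_pos.2 hxy.2
    refine ⟨hpos, x, x.2, ?_⟩
    ext z
    simp only [Set.mem_image, Subtype.exists, exists_and_right, exists_eq_right, Set.mem_inter_iff,
      Metric.mem_ball]
    constructor
    · rintro ⟨hz, hzS⟩
      refine ⟨hz, lt_of_le_of_ne (hle ⟨z, hz⟩ x) fun h => hin S hS ⟨z, hz⟩ hzS x hx ⟨?_, ?_⟩⟩
      · rw [diam_univ_subtype]; exact h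
      · rintro rfl
        rw [dist_self] at h
        exact hpos.ne h
    · rintro ⟨hz, hzx⟩
      refine ⟨hz, ?_⟩
      by_contra hzS
      obtain ⟨Q, ⟨hQ, hzQ⟩, -⟩ := hP.2 ⟨z, hz⟩
      have h := (hout Q hQ S hS (by rintro rfl; exact hzS hzQ) _ hzQ x hx).1
      rw [diam_univ_subtype] at h
      exact hzx.ne h
  · rintro ⟨hpos, x, hx, rfl⟩
    let s : Setoid A :=
      { r := fun y z => dist y z < Metric.diam A
        iseqv := ⟨fun y => by rwa [dist_self], fun {y z} h => by rwa [dist_comm],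
          fun {y z w} h h' => (dist_triangle_max y z w).trans_lt (max_lt h h')⟩ }
    have hs : ∀ y z : A, s y z ↔ dist y z < Metric.diam A := fun _ _ => Iff.rfl
    refine ⟨{y : A | s y ⟨x, hx⟩}, ⟨s.classes, ⟨Setoid.isPartition_classes s, ?_, ?_, ?_⟩,
      s.mem_classes _⟩, ?_⟩
    · refine ⟨_, s.mem_classes ⟨a, ha⟩, _, s.mem_classes ⟨b, hb'⟩, fun h => ?_⟩
      have h1 : (⟨a, ha⟩ : A) ∈ {y : A | s y ⟨b, hb'⟩} := h ▸ s.refl' _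
      exact ((hs _ _).1 h1).ne hab
    · rintro _ ⟨c, rfl⟩ y hy z hz h
      have h1 := (hs _ _).1 (s.trans' hy (s.symm' hz))
      have h2 := h.1
      rw [diam_univ_subtype] at h2
      exact h1.ne h2
    · rintro _ ⟨c, rfl⟩ _ ⟨d, rfl⟩ hne y hy z hz
      have hyz : ¬ s y z := fun h => hne <| by
        have hcd : s c d := s.trans' (s.symm' hy) (s.trans' h hz)
        ext w
        exact ⟨fun hw => s.trans' hw hcd, fun hw => s.trans' hw (s.symm' hcd)⟩
      refine ⟨?_, by rintro rfl; exact hyz (s.refl' _)⟩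
      rw [diam_univ_subtype]
      exact le_antisymm (hle y z) (not_lt.1 fun h => hyz h)
    · ext z
      constructor
      · rintro ⟨hz, hzx⟩
        exact ⟨⟨z, hz⟩, hzx, rfl⟩
      · rintro ⟨y, hy, rfl⟩
        exact ⟨y.2, hy⟩

/-- In a totally bounded ultrametric space only finitely many distances exceed a given positive
number: such a distance does not change when both points are moved to a finite net. -/
theorem finite_setOf_dist_ge [IsUltrametricDist X] (hX : TotallyBounded (Set.univ : Set X))
    {ε : ℝ} (hε : 0 < ε) : {d | ε ≤ d ∧ ∃ x y : X, dist x y = d}.Finite := by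
  obtain ⟨t, ht, hcov⟩ := Metric.totallyBounded_iff.1 hX ε hε
  refine ((ht.prod ht).image fun p => dist p.1 p.2).subset ?_
  rintro _ ⟨hd, x, y, rfl⟩
  have hnet : ∀ x : X, ∃ s ∈ t, dist x s < ε := fun x => by simpa using hcov (Set.mem_univ x)
  have hmove : ∀ x s y : X, dist x s < ε → ε ≤ dist x y → dist s y = dist x y := by
    intro x s y hxs hxy
    apply le_antisymm
    · refine (dist_triangle_max s x y).trans (max_le ?_ le_rfl)
      rw [dist_comm]
      exact hxs.le.trans hxy
    · exact (le_max_iff.1 (dist_triangle_max x s y)).resolve_left (hxs.trans_le hxy).not_ge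
  obtain ⟨s, hs, hxs⟩ := hnet x
  obtain ⟨s', hs', hys⟩ := hnet y
  refine ⟨(s, s'), ⟨hs, hs'⟩, ?_⟩
  have h1 := hmove x s y hxs hd
  have h2 := hmove y s' s hys (by rwa [dist_comm, h1])
  change dist s s' = dist x y
  rw [dist_comm, h2, dist_comm, h1]

theorem diamAttained_of_totallyBounded [IsUltrametricDist X]
    (hX : TotallyBounded (Set.univ : Set X)) (hA : A.Nonempty) : DiamAttained A := by
  have hb : Bornology.IsBounded A := (hX.subset A.subset_univ).isBounded
  refine ⟨hb, ?_⟩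
  obtain ⟨a, ha⟩ := hA
  by_cases h : ∃ x ∈ A, ∃ y ∈ A, 0 < dist x y
  · obtain ⟨x, hx, y, hy, hxy⟩ := h
    -- the distances in `A` that are at least `dist x y` have a maximum
    have hfin : {d | dist x y ≤ d ∧ ∃ z ∈ A, ∃ w ∈ A, dist z w = d}.Finite :=
      (finite_setOf_dist_ge hX hxy).subset fun d ⟨hd, z, _, w, _, e⟩ => ⟨hd, z, w, e⟩
    obtain ⟨m, ⟨hm, z, hz, w, hw, rfl⟩, hmax⟩ :=
      Set.exists_max_image _ id hfin ⟨dist x y, le_rfl, x, hx, y, hy, rfl⟩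
    refine ⟨z, hz, w, hw, le_antisymm (Metric.dist_le_diam_of_mem hb hz hw)
      (Metric.diam_le_of_forall_dist_le dist_nonneg fun p hp q hq => ?_)⟩
    rcases le_total (dist x y) (dist p q) with h | h
    · exact hmax _ ⟨h, p, hp, q, hq, rfl⟩
    · exact h.trans hm
  · push Not at h
    refine ⟨a, ha, a, ha, le_antisymm (by simp [Metric.diam_nonneg]) ?_⟩
    exact Metric.diam_le_of_forall_dist_le dist_nonneg fun p hp q hq => by
      simpa using h p hp q hq

theorem nonempty_of_isDiamPart (h : IsDiamPart A B) : B.Nonempty := by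
  obtain ⟨S, ⟨P, hP, hS⟩, rfl⟩ := h
  exact (Setoid.nonempty_of_mem_partition hP.1 hS).image _

theorem nonempty_of_mem_reprVertices [Nonempty X] (h : A ∈ reprVertices X) : A.Nonempty := by
  rcases Relation.ReflTransGen.cases_tail h with rfl | ⟨B, -, hB⟩
  · exact Set.univ_nonempty
  · exact nonempty_of_isDiamPart hB

theorem diam_lt_of_isDiamPart [IsUltrametricDist X] (hX : TotallyBounded (Set.univ : Set X))
    (hA : A.Nonempty) (h : IsDiamPart A B) : Metric.diam B < Metric.diam A := by
  obtain ⟨_, x, hx, y, hy, hxy⟩ := diamAttained_of_totallyBounded hX (nonempty_of_isDiamPart h)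
  obtain ⟨-, c, -, rfl⟩ := (isDiamPart_iff (diamAttained_of_totallyBounded hX hA)).1 h
  rw [← hxy]
  exact (dist_triangle_max x c y).trans_lt (max_lt hx.2 (by rw [dist_comm]; exact hy.2))

theorem finite_setOf_isDiamPart [IsUltrametricDist X] (hX : TotallyBounded (Set.univ : Set X))
    (hA : A.Nonempty) : {B | IsDiamPart A B}.Finite := by
  have hatt := diamAttained_of_totallyBounded hX hA
  by_cases hpos : 0 < Metric.diam A
  · obtain ⟨t, ht, hcov⟩ := Metric.totallyBounded_iff.1 hX _ hpos
    refine (ht.image fun s => A ∩ Metric.ball s (Metric.diam A)).subset fun B hB => ?_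
    obtain ⟨-, x, hx, rfl⟩ := (isDiamPart_iff hatt).1 hB
    obtain ⟨s, hs, hxs⟩ : ∃ s ∈ t, x ∈ Metric.ball s (Metric.diam A) := by
      simpa using hcov (Set.mem_univ x)
    exact ⟨s, hs, by simp only [IsUltrametricDist.ball_eq_of_mem hxs]⟩
  · convert Set.finite_empty
    ext B
    simp [isDiamPart_iff hatt, hpos]

theorem exists_isDiamPart_ne [IsUltrametricDist X] (hA : DiamAttained A)
    (hpos : 0 < Metric.diam A) : ∃ B C, IsDiamPart A B ∧ IsDiamPart A C ∧ B ≠ C := by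
  obtain ⟨hb, x, hx, y, hy, hxy⟩ := id hA
  refine ⟨_, _, (isDiamPart_iff hA).2 ⟨hpos, x, hx, rfl⟩,
    (isDiamPart_iff hA).2 ⟨hpos, y, hy, rfl⟩, fun h => ?_⟩
  have h1 : x ∈ A ∩ Metric.ball y (Metric.diam A) := h ▸ ⟨hx, Metric.mem_ball_self hpos⟩
  exact (Metric.mem_ball.1 h1.2).ne hxy

end Metric

/-! ### The representing tree of a totally bounded space is monotone -/

section Necessity

variable {V X : Type u} {T : SimpleGraph V} {l : V → ℝ≥0} [MetricSpace X]

theorem reflTransGen_reprVertices {A : Set X} (hA : A ∈ reprVertices X) :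
    ReflTransGen (fun A B : reprVertices X => IsDiamPart (A : Set X) (B : Set X))
      ⟨Set.univ, .refl⟩ ⟨A, hA⟩ := by
  change ReflTransGen _ _ _ at hA
  induction hA with
  | refl => exact .refl
  | tail h h' ih => exact ih.tail h'

/-- A labeled tree isomorphic to the representing tree of a totally bounded ultrametric space is
locally finite, monotonically labeled, and has no vertex of out-degree one. The root corresponds
to the whole space, and the children of a vertex to the parts of its diametrical graph. -/
theorem monotone_of_totallyBounded (hT : T.IsTree) [IsUltrametricDist X] [Nonempty X]
    (hX : TotallyBounded (Set.univ : Set X))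
    (h : LabeledIsomorphic (reprTree X) (reprLabel X) T l) :
    IsLocallyFinite T ∧ ∃ r : V, IsMonotoneLabeling T r l ∧ ∀ v : V, outDegree T r v ≠ 1 := by
  obtain ⟨f, hf⟩ := h
  let S : V → Set X := fun v => (f.symm v : Set X)
  have hSf : ∀ A : reprVertices X, S (f A) = A := fun A => by simp [S]
  have hSinj : Function.Injective S := fun v w h => f.symm.injective (Subtype.ext h)
  have hne : ∀ v, (S v).Nonempty := fun v => nonempty_of_mem_reprVertices (f.symm v).2
  have hatt : ∀ v, DiamAttained (S v) := fun v => diamAttained_of_totallyBounded hX (hne v)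
  have hlab : ∀ v, (l v : ℝ) = Metric.diam (S v) := fun v => by
    have h := hf (f.symm v)
    rw [RelIso.apply_symm_apply] at h
    rw [h]
    rfl
  have hlt : ∀ u v, IsDiamPart (S u) (S v) → l v < l u := fun u v h => by
    rw [← NNReal.coe_lt_coe, hlab, hlab]
    exact diam_lt_of_isDiamPart hX (hne u) h
  let r : V := f ⟨Set.univ, .refl⟩
  have hchild : ∀ u v, Child T r u v ↔ IsDiamPart (S u) (S v) := by
    intro u v
    refine child_iff_of_orientation hT (R := fun u v => IsDiamPart (S u) (S v)) ?_ ?_ hlt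
    · intro u v
      rw [← f.symm.map_adj_iff]
      exact or_comm
    · intro v
      have h := (reflTransGen_reprVertices (f.symm v).2).lift
        (p := fun u v => IsDiamPart (S u) (S v)) f fun A B h => by
          change IsDiamPart (S (f A)) (S (f B))
          rwa [hSf, hSf]
      change ReflTransGen _ r (f (f.symm v)) at h
      rwa [RelIso.apply_symm_apply] at h
  have hsurj : ∀ v B, IsDiamPart (S v) B → ∃ w, S w = B := fun v B hB =>
    ⟨f ⟨B, ReflTransGen.tail (f.symm v).2 hB⟩, hSf _⟩
  refine ⟨(isLocallyFinite_iff hT r).2 fun v => ?_, r, ⟨fun v w hvw => ?_, fun C hC => ?_⟩,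
    fun v => ?_⟩
  · simp only [hchild]
    exact Set.Finite.preimage (f := S) hSinj.injOn (finite_setOf_isDiamPart hX (hne v))
  · exact hlt _ _ ((hchild _ _).1 ((isDirectSuccessor_iff hT).1 hvw))
  · refine ⟨fun _ _ => zero_le, fun b hb => ?_⟩
    by_contra hb0
    have hb0 : 0 < b := not_le.1 hb0
    have hb' : ∀ v ∈ C, b ≤ l v := fun v hv => hb ⟨v, hv, rfl⟩
    have hCne : C.Nonempty := by
      by_contra hC0
      rw [Set.not_nonempty_iff_eq_empty] at hC0
      subst hC0
      have := hC.2 (Set.subsingleton_singleton (a := r)).isChain (Set.empty_subset _)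
      exact Set.singleton_ne_empty r this.symm
    -- the labels of `C` are distances above a positive bound, so they attain a minimum
    have hfin : (l '' C).Finite := by
      refine Set.Finite.of_finite_image (f := ((↑) : ℝ≥0 → ℝ))
        ((finite_setOf_dist_ge hX (NNReal.coe_pos.2 hb0)).subset ?_) NNReal.coe_injective.injOn
      rintro _ ⟨_, ⟨v, hv, rfl⟩, rfl⟩
      obtain ⟨-, x, -, y, -, hxy⟩ := hatt v
      exact ⟨NNReal.coe_le_coe.2 (hb' v hv), x, y, by rw [hxy, hlab]⟩
    obtain ⟨_, ⟨v, hv, rfl⟩, hmin⟩ := Set.exists_min_image _ id hfin (hCne.image l)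
    have hpos : 0 < Metric.diam (S v) := by
      rw [← hlab]
      exact NNReal.coe_pos.2 (hb0.trans_le (hb' v hv))
    obtain ⟨B, -, hB, -⟩ := exists_isDiamPart_ne (hatt v) hpos
    obtain ⟨w, rfl⟩ := hsurj v B hB
    have hvw : Child T r v w := (hchild v w).2 hB
    -- a child `w` of the vertex `v` with the least label lies below all of `C`
    have hbelow : ∀ u ∈ C, RootedLE T r w u := by
      intro u hu
      rw [rootedLE_iff hT]
      have huv : ReflTransGen (Child T r) u v := by
        rcases eq_or_ne u v with rfl | huv
        · exact .refl
        rcases hC.1 hu hv huv with h | h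
        · rw [rootedLE_iff hT] at h
          rcases h.cases_tail with rfl | ⟨z, hvz, hzu⟩
          · exact .refl
          · have hle : l u < l v := (hlt _ _ ((hchild _ _).1 hzu)).trans_le
              (label_le_of_reflTransGen_child (fun u v h => hlt u v ((hchild u v).1 h)) hvz)
            exact absurd (hmin _ ⟨u, hu, rfl⟩) hle.not_ge
        · exact (rootedLE_iff hT).1 h
      exact huv.tail hvw
    have hw : w ∈ C := by
      rw [hC.2 (hC.1.insert fun u hu _ => Or.inl (hbelow u hu)) (Set.subset_insert w C)]
      exact Set.mem_insert w C
    exact absurd (hmin _ ⟨w, hw, rfl⟩) (hlt _ _ hB).not_ge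
  · rw [outDegree_eq hT]
    intro h1
    obtain ⟨w, hw⟩ := Set.encard_eq_one.1 h1
    have hmem : ∀ x, IsDiamPart (S v) (S x) → x = w := fun x hx =>
      (hw ▸ (hchild v x).2 hx : x ∈ ({w} : Set V))
    have hvw : IsDiamPart (S v) (S w) := (hchild v w).1 (hw.symm ▸ rfl : w ∈ {w | Child T r v w})
    obtain ⟨B, D, hB, hD, hBD⟩ := exists_isDiamPart_ne (hatt v) ((isDiamPart_iff (hatt v)).1 hvw).1
    obtain ⟨x, rfl⟩ := hsurj v B hB
    obtain ⟨y, rfl⟩ := hsurj v D hD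
    exact hBD (by rw [hmem x hB, hmem y hD])

end Necessity

/-! ### The space of rays of a labeled tree -/

/-- A ray of the tree `T` starts at the root `r` and steps to a child as long as there is one; at
a leaf it stays forever. Rays thus encode the maximal chains of the rooted tree. -/
@[ext]
structure Ray {V : Type u} (T : SimpleGraph V) (r : V) : Type u where
  /-- The vertex that the ray visits at a given time. -/
  vertex : ℕ → V
  vertex_zero : vertex 0 = r
  step : ∀ n, Child T r (vertex n) (vertex (n + 1)) ∨
    vertex (n + 1) = vertex n ∧ ∀ w, ¬ Child T r (vertex n) w

namespace Ray

variable {V : Type u} {T : SimpleGraph V} {r : V} {l : V → ℝ≥0} {x y z : Ray T r} {n : ℕ} {v w : V}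

theorem vertex_of_leaf (hleaf : ∀ w, ¬ Child T r (x.vertex n) w) (k : ℕ) :
    x.vertex (n + k) = x.vertex n := by
  induction k with
  | zero => rfl
  | succ k ih =>
    rcases x.step (n + k) with h | h
    · rw [ih] at h
      exact (hleaf _ h).elim
    · rw [← add_assoc, h.1, ih]

theorem child_of_not_leaf (h : Child T r (x.vertex n) w) :
    Child T r (x.vertex n) (x.vertex (n + 1)) :=
  (x.step n).resolve_right fun h' => h'.2 w h

theorem dist_vertex_le (x : Ray T r) (n : ℕ) : T.dist r (x.vertex n) ≤ n := by
  induction n with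
  | zero => rw [x.vertex_zero, T.dist_self]
  | succ n ih =>
    rcases x.step n with h | h
    · have := h.2
      omega
    · rw [h.1]
      omega

theorem dist_vertex_eq_or_leaf (x : Ray T r) (n : ℕ) :
    T.dist r (x.vertex n) = n ∨ ∀ w, ¬ Child T r (x.vertex n) w := by
  induction n with
  | zero => rw [x.vertex_zero, T.dist_self]; exact Or.inl rfl
  | succ n ih =>
    rcases x.step n with h | h
    · rcases ih with ih | ih
      · exact Or.inl (by rw [h.2, ih])
      · exact (ih _ h).elim
    · exact Or.inr (h.1 ▸ h.2)

/-- A ray through `v` visits `v` at the time given by the distance of `v` from the root. -/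
theorem vertex_dist (x : Ray T r) (n : ℕ) : x.vertex (T.dist r (x.vertex n)) = x.vertex n := by
  induction n with
  | zero => rw [x.vertex_zero, T.dist_self, x.vertex_zero]
  | succ n ih =>
    rcases x.step n with h | h
    · rcases x.dist_vertex_eq_or_leaf n with h' | h'
      · rw [h.2, h']
      · exact (h' _ h).elim
    · rw [h.1, ih]

/-- The rays through the vertex `v`. By `vertex_dist` a ray that visits `v` at any time does so at
the time `T.dist r v`. -/
def through (T : SimpleGraph V) (r v : V) : Set (Ray T r) :=
  {x | x.vertex (T.dist r v) = v}

theorem mem_through_vertex (x : Ray T r) (n : ℕ) : x ∈ through T r (x.vertex n) :=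
  x.vertex_dist n

theorem through_root : through T r r = Set.univ :=
  Set.eq_univ_of_forall fun x => by
    rw [through, Set.mem_ofPred_eq, T.dist_self, x.vertex_zero]

theorem vertex_eq_of_mem_through (hT : T.IsTree) (hx : x ∈ through T r v)
    (hy : y ∈ through T r v) {m : ℕ} (hm : m ≤ T.dist r v) : x.vertex m = y.vertex m := by
  induction hn : T.dist r v generalizing v with
  | zero =>
    obtain rfl : m = 0 := by omega
    rw [x.vertex_zero, y.vertex_zero]
  | succ n ih =>
    rcases hm.eq_or_lt with rfl | hm
    · exact hx.trans hy.symm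
    have hch : ∀ x : Ray T r, x ∈ through T r v → Child T r (x.vertex n) v := by
      intro x hx
      rw [through, Set.mem_ofPred_eq, hn] at hx
      rcases x.step n with h | h
      · rwa [hx] at h
      · have := x.dist_vertex_le n
        rw [← h.1, hx] at this
        omega
    have hxy : x.vertex n = y.vertex n := (hch x hx).parent_unique hT (hch y hy)
    have hd := (hch x hx).2
    exact ih (x.mem_through_vertex n) (hxy ▸ y.mem_through_vertex n) (by omega) (by omega)

theorem through_subset_of_child (hT : T.IsTree) (h : Child T r v w) :
    through T r w ⊆ through T r v := by
  intro x hx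
  rw [through, Set.mem_ofPred_eq, h.2] at hx
  have hxv : Child T r (x.vertex (T.dist r v)) w := by
    rcases x.step (T.dist r v) with h' | h'
    · rwa [hx] at h'
    · have := x.dist_vertex_le (T.dist r v)
      rw [← h'.1, hx, h.2] at this
      omega
  exact hxv.parent_unique hT h

/-- Every vertex lies on a ray: follow a ray through its parent, then step to arbitrary children
while there are any. -/
theorem through_nonempty (hT : T.IsTree) (v : V) : (through T r v).Nonempty := by
  classical
  let g : V → V := fun v => if h : ∃ w, Child T r v w then h.choose else v
  have hg : ∀ v, Child T r v (g v) ∨ g v = v ∧ ∀ w, ¬ Child T r v w := by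
    intro v
    by_cases h : ∃ w, Child T r v w
    · exact Or.inl (by simp only [g, dif_pos h]; exact h.choose_spec)
    · exact Or.inr ⟨by simp only [g, dif_neg h], not_exists.1 h⟩
  induction reflTransGen_child_root hT r v with
  | refl =>
    refine ⟨⟨fun n => g^[n] r, rfl, fun n => ?_⟩, by simp [through]⟩
    rw [Function.iterate_succ_apply']
    exact hg _
  | @tail u v _ huv ih =>
    obtain ⟨x, hx⟩ := ih
    rw [through, Set.mem_ofPred_eq] at hx
    refine ⟨⟨fun n => if n ≤ T.dist r u then x.vertex n else g^[n - (T.dist r u + 1)] v,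
      by simp [x.vertex_zero], fun n => ?_⟩, ?_⟩
    · rcases lt_trichotomy n (T.dist r u) with h | rfl | h
      · rw [if_pos h.le, if_pos (by omega)]
        exact x.step n
      · rw [if_pos le_rfl, if_neg (by omega), Nat.sub_self, hx]
        exact Or.inl huv
      · rw [if_neg (by omega), if_neg (by omega),
          show n + 1 - (T.dist r u + 1) = (n - (T.dist r u + 1)) + 1 by omega,
          Function.iterate_succ_apply']
        exact hg _
    · rw [through, Set.mem_ofPred_eq, huv.2]
      simp

theorem reflTransGen_child_vertex {m : ℕ} (h : m ≤ n) :
    ReflTransGen (Child T r) (x.vertex m) (x.vertex n) := by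
  induction n, h using Nat.le_induction with
  | base => exact .refl
  | succ n _ ih =>
    rcases x.step n with h | h
    · exact ih.tail h
    · rwa [h.1]

theorem mem_range_of_reflTransGen (hT : T.IsTree) (h : ReflTransGen (Child T r) w (x.vertex n)) :
    w ∈ Set.range x.vertex := by
  induction n with
  | zero =>
    rcases h.cases_tail with h | ⟨u, -, h⟩
    · exact ⟨0, h⟩
    · rw [x.vertex_zero] at h
      exact (not_child_root h).elim
  | succ n ih =>
    rcases x.step n with h' | h'
    · rcases (reflTransGen_child_iff hT h').1 h with h | h
      · exact ⟨n + 1, h.symm⟩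
      · exact ih h
    · rw [h'.1] at h
      exact ih h

/-- The vertices of a ray form a maximal chain, so that the labels along it have infimum zero. -/
theorem isMaxChain_range (hT : T.IsTree) (x : Ray T r) :
    IsMaxChain (RootedLE T r) (Set.range x.vertex) := by
  constructor
  · rintro _ ⟨m, rfl⟩ _ ⟨n, rfl⟩ -
    simp only [rootedLE_iff hT]
    exact (le_total n m).imp reflTransGen_child_vertex reflTransGen_child_vertex
  · intro C hC hsub
    refine hsub.antisymm fun w hw => ?_
    -- past the depth of `w` the ray cannot lie above `w`, unless it has stopped at `w`
    let n := T.dist r w + 1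
    rcases eq_or_ne w (x.vertex n) with h | hne
    · exact ⟨n, h.symm⟩
    rcases hC hw (hsub ⟨n, rfl⟩) hne with h | h <;> rw [rootedLE_iff hT] at h
    · rcases x.dist_vertex_eq_or_leaf n with hn | hn
      · have := dist_le_of_reflTransGen_child h
        omega
      · rcases h.cases_head with h | ⟨u, hu, -⟩
        · exact ⟨n, h⟩
        · exact (hn u hu).elim
    · exact mem_range_of_reflTransGen hT h

theorem exists_label_lt (hT : T.IsTree) (hl : IsMonotoneLabeling T r l) (x : Ray T r) {ε : ℝ≥0}
    (hε : 0 < ε) : ∃ n, l (x.vertex n) < ε := by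
  by_contra! h
  refine hε.not_ge ((hl.2 _ (x.isMaxChain_range hT)).2 ?_)
  rintro _ ⟨_, ⟨n, rfl⟩, rfl⟩
  exact h n

/-! ### The distance between rays -/

open Classical in
/-- The distance between two different rays is the label of the last vertex before they
separate. -/
noncomputable def rayDist (l : V → ℝ≥0) (x y : Ray T r) : ℝ≥0 :=
  if x = y then 0 else l (x.vertex (PiNat.firstDiff x.vertex y.vertex - 1))

theorem rayDist_self : rayDist l x x = 0 := if_pos rfl

theorem exists_rayDist_eq (l : V → ℝ≥0) (h : x ≠ y) :
    ∃ n, (∀ m ≤ n, x.vertex m = y.vertex m) ∧ x.vertex (n + 1) ≠ y.vertex (n + 1) ∧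
      rayDist l x y = l (x.vertex n) := by
  have hv : x.vertex ≠ y.vertex := fun e => h (Ray.ext e)
  have hne := PiNat.apply_firstDiff_ne hv
  have h0 : PiNat.firstDiff x.vertex y.vertex ≠ 0 := fun e => hne (by
    rw [e, x.vertex_zero, y.vertex_zero])
  obtain ⟨n, hn⟩ := Nat.exists_eq_succ_of_ne_zero h0
  refine ⟨n, fun m hm => PiNat.apply_eq_of_lt_firstDiff (by omega), by rwa [hn] at hne, ?_⟩
  rw [rayDist, if_neg h, hn]
  rfl

theorem label_antitone (hl : ∀ u v, Child T r u v → l v < l u) (x : Ray T r) :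
    Antitone fun n => l (x.vertex n) :=
  antitone_nat_of_succ_le fun n => by
    rcases x.step n with h | h
    · exact (hl _ _ h).le
    · rw [h.1]

theorem rayDist_le (hl : ∀ u v, Child T r u v → l v < l u)
    (h : ∀ m ≤ n, x.vertex m = y.vertex m) : rayDist l x y ≤ l (x.vertex n) := by
  by_cases hxy : x = y
  · rw [hxy, rayDist_self]
    exact zero_le
  · obtain ⟨k, -, hk', e⟩ := exists_rayDist_eq l hxy
    rw [e]
    exact x.label_antitone hl (not_lt.1 fun hkn => hk' (h _ hkn))

theorem le_rayDist (hl : ∀ u v, Child T r u v → l v < l u)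
    (h : x.vertex (n + 1) ≠ y.vertex (n + 1)) : l (x.vertex n) ≤ rayDist l x y := by
  obtain ⟨k, hk, -, e⟩ := exists_rayDist_eq l (x := x) (y := y) (by rintro rfl; exact h rfl)
  rw [e]
  exact x.label_antitone hl (Nat.le_of_lt_succ (not_le.1 fun hkn => h (hk _ hkn)))

theorem rayDist_comm (l : V → ℝ≥0) (x y : Ray T r) : rayDist l x y = rayDist l y x := by
  by_cases hxy : x = y
  · rw [hxy]
  · obtain ⟨n, hn, -, e⟩ := exists_rayDist_eq l hxy
    rw [e, rayDist, if_neg (Ne.symm hxy)]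
    rw [rayDist, if_neg hxy] at e
    rw [PiNat.firstDiff_comm, ← e]
    have hv : x.vertex ≠ y.vertex := fun e => hxy (Ray.ext e)
    have h0 : PiNat.firstDiff x.vertex y.vertex ≠ 0 := fun e =>
      PiNat.apply_firstDiff_ne hv (by rw [e, x.vertex_zero, y.vertex_zero])
    rw [PiNat.apply_eq_of_lt_firstDiff (Nat.sub_one_lt h0)]

theorem rayDist_le_max (hl : ∀ u v, Child T r u v → l v < l u) (x y z : Ray T r) :
    rayDist l x z ≤ max (rayDist l x y) (rayDist l y z) := by
  by_cases hxz : x = z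
  · rw [hxz, rayDist_self]
    exact zero_le
  · obtain ⟨n, hn, hne, e⟩ := exists_rayDist_eq l hxz
    by_cases h : x.vertex (n + 1) = y.vertex (n + 1)
    · refine le_max_of_le_right ?_
      rw [e, hn n le_rfl, rayDist_comm]
      exact le_rayDist hl fun h' => hne (h.trans h'.symm)
    · exact le_max_of_le_left (e ▸ le_rayDist hl h)

theorem eq_of_rayDist_eq_zero (hl : ∀ u v, Child T r u v → l v < l u) (h : rayDist l x y = 0) :
    x = y := by
  by_contra hxy
  obtain ⟨n, hn, hne, e⟩ := exists_rayDist_eq l hxy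
  have hleaf : ∀ w, ¬ Child T r (x.vertex n) w := fun w hw =>
    not_lt_zero ((hl _ _ hw).trans_eq (e.symm.trans h))
  apply hne
  rw [x.vertex_of_leaf hleaf 1, y.vertex_of_leaf (hn n le_rfl ▸ hleaf) 1, hn n le_rfl]

/-- The metric on the space of rays. It depends on the labeling, hence is not an instance. -/
@[reducible]
noncomputable def metricSpace (hl : ∀ u v, Child T r u v → l v < l u) : MetricSpace (Ray T r) where
  dist x y := rayDist l x y
  dist_self x := by rw [rayDist_self]; rfl
  dist_comm x y := by rw [rayDist_comm]
  dist_triangle x y z := by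
    rw [← NNReal.coe_add, NNReal.coe_le_coe]
    exact (rayDist_le_max hl x y z).trans (max_le_add_of_nonneg zero_le zero_le)
  eq_of_dist_eq_zero h := eq_of_rayDist_eq_zero hl (NNReal.coe_eq_zero.1 h)

theorem isUltrametricDist (hl : ∀ u v, Child T r u v → l v < l u) :
    letI := metricSpace hl
    IsUltrametricDist (Ray T r) :=
  letI := metricSpace hl
  ⟨fun x y z => by
    change (rayDist l x z : ℝ) ≤ max (rayDist l x y : ℝ) (rayDist l y z)
    exact_mod_cast rayDist_le_max hl x y z⟩

theorem rayDist_le_of_mem_through (hT : T.IsTree) (hl : ∀ u v, Child T r u v → l v < l u)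
    (hx : x ∈ through T r v) (hy : y ∈ through T r v) : rayDist l x y ≤ l v := by
  have h := rayDist_le (n := T.dist r v) hl fun m hm => vertex_eq_of_mem_through hT hx hy hm
  rwa [show x.vertex (T.dist r v) = v from hx] at h

theorem label_eq_zero_of_leaf (hT : T.IsTree) (hl : IsMonotoneLabeling T r l)
    (hleaf : ∀ w, ¬ Child T r v w) : l v = 0 := by
  obtain ⟨x, hx⟩ := through_nonempty (r := r) hT v
  rw [through, Set.mem_ofPred_eq] at hx
  have hlt := hl.lt_of_child hT
  refine le_zero_iff.1 ((hl.2 _ (x.isMaxChain_range hT)).2 ?_)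
  rintro _ ⟨_, ⟨n, rfl⟩, rfl⟩
  rcases le_total n (T.dist r v) with h | h
  · rw [← hx]
    exact x.label_antitone hlt h
  · obtain ⟨k, rfl⟩ := Nat.exists_eq_add_of_le h
    rw [x.vertex_of_leaf (hx.symm ▸ hleaf), hx]

/-- Since no vertex has exactly one child, the rays through `v` have diameter `l v`: rays through
two different children of `v` separate at `v`. -/
theorem exists_rayDist_eq_label (hT : T.IsTree) (hl : IsMonotoneLabeling T r l)
    (hdeg : outDegree T r v ≠ 1) :
    ∃ x ∈ through T r v, ∃ y ∈ through T r v, rayDist l x y = l v := by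
  have hlt := hl.lt_of_child hT
  by_cases h : ∃ w, Child T r v w
  · obtain ⟨w, hw⟩ := h
    obtain ⟨w', hw', hne⟩ : ∃ w', Child T r v w' ∧ w' ≠ w := by
      by_contra! h
      refine hdeg ?_
      rw [outDegree_eq hT, Set.encard_eq_one]
      exact ⟨w, Set.eq_singleton_iff_unique_mem.2 ⟨hw, h⟩⟩
    obtain ⟨x, hx⟩ := through_nonempty (r := r) hT w
    obtain ⟨y, hy⟩ := through_nonempty (r := r) hT w'
    have hxv := through_subset_of_child hT hw hx
    have hyv := through_subset_of_child hT hw' hy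
    refine ⟨x, hxv, y, hyv, le_antisymm (rayDist_le_of_mem_through hT hlt hxv hyv) ?_⟩
    rw [through, Set.mem_ofPred_eq, hw.2] at hx
    rw [through, Set.mem_ofPred_eq, hw'.2] at hy
    have h := le_rayDist hlt (x := x) (y := y) (n := T.dist r v) (by rw [hx, hy]; exact hne.symm)
    rwa [show x.vertex (T.dist r v) = v from hxv] at h
  · obtain ⟨x, hx⟩ := through_nonempty (r := r) hT v
    exact ⟨x, hx, x, hx, by rw [rayDist_self, label_eq_zero_of_leaf hT hl (not_exists.1 h)]⟩

theorem rayDist_lt_label_iff (hT : T.IsTree) (hl : ∀ u v, Child T r u v → l v < l u)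
    (hxw : x ∈ through T r w) (hw : Child T r v w) :
    y ∈ through T r v ∧ rayDist l y x < l v ↔ y ∈ through T r w := by
  constructor
  · rintro ⟨hy, hlt⟩
    by_contra hyw
    rw [through, Set.mem_ofPred_eq, hw.2] at hxw hyw
    have h := le_rayDist hl (x := y) (y := x) (n := T.dist r v) (by rwa [hxw])
    rw [show y.vertex (T.dist r v) = v from hy] at h
    exact hlt.not_ge h
  · intro hy
    exact ⟨through_subset_of_child hT hw hy,
      (rayDist_le_of_mem_through hT hl hy hxw).trans_lt (hl _ _ hw)⟩

theorem exists_child_mem_through (hx : x ∈ through T r v) (hw : Child T r v w) :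
    ∃ u, Child T r v u ∧ x ∈ through T r u := by
  rw [through, Set.mem_ofPred_eq] at hx
  have h := x.child_of_not_leaf (n := T.dist r v) (w := w) (by rwa [hx])
  rw [hx] at h
  exact ⟨_, h, x.mem_through_vertex _⟩

theorem label_le_of_through_subset (hT : T.IsTree) (hl : IsMonotoneLabeling T r l)
    (hdeg : outDegree T r v ≠ 1) (h : through T r v ⊆ through T r w) : l v ≤ l w := by
  obtain ⟨x, hx, y, hy, e⟩ := exists_rayDist_eq_label hT hl hdeg
  rw [← e]
  exact rayDist_le_of_mem_through hT (hl.lt_of_child hT) (h hx) (h hy)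

/-- A vertex is determined by the rays through it: two vertices on a common ray are comparable,
and comparable vertices with equal labels coincide. -/
theorem through_injective (hT : T.IsTree) (hl : IsMonotoneLabeling T r l)
    (hdeg : ∀ v, outDegree T r v ≠ 1) : Function.Injective (through T r) := by
  intro v w h
  have hlt := hl.lt_of_child hT
  have key : ∀ v w, l v ≤ l w → ReflTransGen (Child T r) v w → v = w := by
    intro v w hle hvw
    rcases hvw.cases_head with h | ⟨u, hu, huw⟩
    · exact h
    · exact absurd (hle.trans (label_le_of_reflTransGen_child hlt huw)) (hlt _ _ hu).not_ge
  obtain ⟨x, hx⟩ := through_nonempty (r := r) hT v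
  have hxw : x ∈ through T r w := h ▸ hx
  rw [through, Set.mem_ofPred_eq] at hx hxw
  rcases le_total (T.dist r v) (T.dist r w) with hd | hd <;>
    have hr := reflTransGen_child_vertex (x := x) hd <;> rw [hx, hxw] at hr
  · exact key v w (label_le_of_through_subset hT hl (hdeg v) h.subset) hr
  · exact (key w v (label_le_of_through_subset hT hl (hdeg w) h.superset) hr).symm

theorem diam_through (hT : T.IsTree) (hl : IsMonotoneLabeling T r l)
    (hdeg : outDegree T r v ≠ 1) :
    letI := metricSpace (hl.lt_of_child hT)
    Metric.diam (through T r v) = l v ∧ DiamAttained (through T r v) := by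
  let := metricSpace (hl.lt_of_child hT)
  have hle : ∀ x ∈ through T r v, ∀ y ∈ through T r v, dist x y ≤ l v := fun x hx y hy =>
    NNReal.coe_le_coe.2 (rayDist_le_of_mem_through hT (hl.lt_of_child hT) hx hy)
  have hb : Bornology.IsBounded (through T r v) := Metric.isBounded_iff.2 ⟨l v, hle⟩
  obtain ⟨x, hx, y, hy, e⟩ := exists_rayDist_eq_label hT hl hdeg
  have e' : dist x y = l v := congrArg NNReal.toReal e
  have hd : Metric.diam (through T r v) = l v :=
    le_antisymm (Metric.diam_le_of_forall_dist_le (l v).2 hle)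
      (e' ▸ Metric.dist_le_diam_of_mem hb hx hy)
  exact ⟨hd, hb, x, hx, y, hy, e'.trans hd.symm⟩

/-- The parts of the diametrical graph on the rays through `v` are the sets of rays through the
children of `v`, since two rays through `v` are closer than `l v` exactly when they continue to the
same child. -/
theorem isDiamPart_through_iff (hT : T.IsTree) (hl : IsMonotoneLabeling T r l)
    (hdeg : outDegree T r v ≠ 1) {S : Set (Ray T r)} :
    letI := metricSpace (hl.lt_of_child hT)
    IsDiamPart (through T r v) S ↔ ∃ w, Child T r v w ∧ S = through T r w := by
  have hlt := hl.lt_of_child hT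
  let := metricSpace hlt
  have := isUltrametricDist hlt
  obtain ⟨hd, hatt⟩ := diam_through hT hl hdeg
  have hball : ∀ x w, x ∈ through T r w → Child T r v w →
      through T r v ∩ Metric.ball x (l v) = through T r w := fun x w hx hw => by
    ext y
    exact (and_congr_right fun _ => NNReal.coe_lt_coe).trans (rayDist_lt_label_iff hT hlt hx hw)
  rw [isDiamPart_iff hatt, hd]
  constructor
  · rintro ⟨hpos, x, hx, rfl⟩
    obtain ⟨w, hw⟩ : ∃ w, Child T r v w := by
      by_contra! h
      rw [label_eq_zero_of_leaf hT hl h] at hpos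
      exact lt_irrefl _ hpos
    obtain ⟨u, hu, hxu⟩ := exists_child_mem_through hx hw
    exact ⟨u, hu, hball x u hxu hu⟩
  · rintro ⟨w, hw, rfl⟩
    obtain ⟨x, hx⟩ := through_nonempty (r := r) hT w
    exact ⟨NNReal.coe_pos.2 (bot_le.trans_lt (hlt _ _ hw)), x, through_subset_of_child hT hw hx,
      (hball x w hx hw).symm⟩

/-- For a locally finite tree the space of rays is compact: an ultrafilter on it selects, one
child after the other, a ray to which it converges. -/
theorem compactSpace (hT : T.IsTree) (hl : IsMonotoneLabeling T r l)
    (hfin : ∀ v, {w | Child T r v w}.Finite) :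
    letI := metricSpace (hl.lt_of_child hT)
    CompactSpace (Ray T r) := by
  have hlt := hl.lt_of_child hT
  let := metricSpace hlt
  refine ⟨isCompact_iff_ultrafilter_le_nhds.2 fun F _ => ?_⟩
  have hnext : ∀ v : {v // through T r v ∈ F}, ∃ w : {v // through T r v ∈ F},
      Child T r v w ∨ w.1 = v.1 ∧ ∀ u, ¬ Child T r v u := by
    rintro ⟨v, hv⟩
    by_cases h : ∃ w, Child T r v w
    · obtain ⟨w, hw⟩ := h
      have hcov : (⋃ u ∈ {u | Child T r v u}, through T r u) ∈ F :=
        Filter.mem_of_superset hv fun x hx => by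
          obtain ⟨u, hu, hxu⟩ := exists_child_mem_through hx hw
          exact Set.mem_biUnion hu hxu
      obtain ⟨u, hu, huF⟩ := (Ultrafilter.finite_biUnion_mem_iff (hfin v)).1 hcov
      exact ⟨⟨u, huF⟩, Or.inl hu⟩
    · exact ⟨⟨v, hv⟩, Or.inr ⟨rfl, not_exists.1 h⟩⟩
  choose g hg using hnext
  let v₀ : {v // through T r v ∈ F} := ⟨r, by rw [through_root]; exact Filter.univ_mem⟩
  let x : Ray T r := ⟨fun n => (g^[n] v₀).1, rfl, fun n => by
    rw [Function.iterate_succ_apply']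
    exact hg _⟩
  refine ⟨x, Set.mem_univ x, Metric.nhds_basis_ball.ge_iff.2 fun ε hε => ?_⟩
  obtain ⟨n, hn⟩ := exists_label_lt hT hl x (ε := ⟨ε, hε.le⟩) hε
  refine Filter.mem_of_superset (g^[n] v₀).2 fun y hy => ?_
  exact (NNReal.coe_le_coe.2
    (rayDist_le_of_mem_through hT hlt hy (x.mem_through_vertex n))).trans_lt hn

end Ray

/-! ### Recognizing the representing tree -/

/-- A family of subsets of `X` indexed by the vertices of a rooted tree realizes that tree as the
representing tree if the root is sent to the whole space and the children of a vertex are sent to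
the parts of its diametrical graph. -/
theorem labeledIsomorphic_of_family {V X : Type u} [MetricSpace X] {T : SimpleGraph V}
    {l : V → ℝ≥0} (hT : T.IsTree) {r : V} {B : V → Set X} (hroot : B r = Set.univ)
    (hinj : Function.Injective B)
    (hpart : ∀ v S, IsDiamPart (B v) S ↔ ∃ w, Child T r v w ∧ S = B w)
    (hdiam : ∀ v, Metric.diam (B v) = l v) :
    LabeledIsomorphic (reprTree X) (reprLabel X) T l := by
  have hmem : ∀ v, B v ∈ reprVertices X := by
    intro v
    induction reflTransGen_child_root hT r v with
    | refl => rw [hroot]; exact .refl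
    | tail _ h ih => exact ReflTransGen.tail ih ((hpart _ _).2 ⟨_, h, rfl⟩)
  have hsurj : ∀ A ∈ reprVertices X, ∃ v, B v = A := by
    intro A hA
    change ReflTransGen _ _ _ at hA
    induction hA with
    | refl => exact ⟨r, hroot⟩
    | tail _ h ih =>
      obtain ⟨v, rfl⟩ := ih
      obtain ⟨w, -, rfl⟩ := (hpart _ _).1 h
      exact ⟨w, rfl⟩
  have hchild : ∀ v w, IsDiamPart (B v) (B w) ↔ Child T r v w := by
    intro v w
    rw [hpart]
    refine ⟨?_, fun h => ⟨w, h, rfl⟩⟩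
    rintro ⟨u, hu, e⟩
    rwa [hinj e]
  let e : V ≃ reprVertices X := Equiv.ofBijective (fun v => ⟨B v, hmem v⟩)
    ⟨fun v w h => hinj (congrArg Subtype.val h), fun A => by
      obtain ⟨v, hv⟩ := hsurj A A.2
      exact ⟨v, Subtype.ext hv⟩⟩
  let f : T ≃g reprTree X :=
    { toEquiv := e
      map_rel_iff' := fun {v w} => by
        rw [adj_iff_child hT r, ← hchild, ← hchild]
        exact or_comm }
  refine ⟨f.symm, fun A => ?_⟩
  obtain ⟨v, rfl⟩ := f.surjective A
  rw [RelIso.symm_apply_apply]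
  exact NNReal.coe_injective (hdiam v).symm

end UltrametricTree

theorem theorem12 {V : Type u} (T : SimpleGraph V) (hT : T.IsTree) (l : V → ℝ≥0) :
    List.TFAE [
      ∃ (X : Type u) (_ : MetricSpace X), IsUltrametricDist X ∧ Nonempty X ∧ CompactSpace X ∧
        LabeledIsomorphic (reprTree X) (reprLabel X) T l,
      ∃ (Y : Type u) (_ : MetricSpace Y), IsUltrametricDist Y ∧ Nonempty Y ∧
        TotallyBounded (Set.univ : Set Y) ∧
        LabeledIsomorphic (reprTree Y) (reprLabel Y) T l,
      IsLocallyFinite T ∧ ∃ r : V, IsMonotoneLabeling T r l ∧ ∀ v : V, outDegree T r v ≠ 1] := by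
  tfae_have 1 → 2 := fun ⟨X, m, hu, hne, hc, h⟩ => ⟨X, m, hu, hne, isCompact_univ.totallyBounded, h⟩
  tfae_have 2 → 3 := fun ⟨_, _, _, _, hb, h⟩ => monotone_of_totallyBounded hT hb h
  tfae_have 3 → 1 := by
    rintro ⟨hfin, r, hl, hdeg⟩
    refine ⟨Ray T r, Ray.metricSpace (hl.lt_of_child hT), Ray.isUltrametricDist _,
      (Ray.through_nonempty hT r).to_type, Ray.compactSpace hT hl ((isLocallyFinite_iff hT r).1 hfin),
      ?_⟩
    let := Ray.metricSpace (hl.lt_of_child hT)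
    exact labeledIsomorphic_of_family hT Ray.through_root (Ray.through_injective hT hl hdeg)
      (fun v _ => Ray.isDiamPart_through_iff hT hl (hdeg v))
      fun v => (Ray.diam_through hT hl (hdeg v)).1
  tfae_finish
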